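/- Let $\mathbb T=\{\zeta\in\mathbb C:|\zeta|=1\}$ and let $T_1,T_0$ be contractions on a complex Hilbert space such that $T_1-T_0$ is of trace class. A (complex-valued) function $\xi\in L^1(\mathbb T)$ is called a spectral shift function for the pair $\{T_1,T_0\}$ if $$\operatorname{trace}\big((T_1-\lambda I)^{-1}-(T_0-\lambda I)^{-1}\big)=-\int_{\mathbb T}\frac{\xi(\zeta)}{(\zeta-\lambda)^2}\,d\zeta\qquad\text{for all }\lambda\in\mathbb C\text{ with }|\lambda|>1 .$$ Let $\xi$ be a spectral shift function for $\{T_1,T_0\}$. 1. If $(\operatorname{Im}\xi)\log(1+|\operatorname{Im}\xi|)\in L^1(\mathbb T)$, then there exists a real-valued spectral shift function for $\{T_1,T_0\}$. 2. Conversely, if $\operatorname{Im}\xi\ge 0$ a.e. on $\mathbb T$ and there exists a real-valued spectral shift function for $\{T_1,T_0\}$, then $(\operatorname{Im}\xi)\log(1+|\operatorname{Im}\xi|)\in L^1(\mathbb T)$. -/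

import Mathlib

open MeasureTheory

/-- A bounded operator `A` on a complex Hilbert space is of trace class if
`∑ ⟨|A| eᵢ, eᵢ⟩ < ∞` for an orthonormal basis `(eᵢ)`, where `|A| = (A* A)^(1/2)`.
(The sum of these nonnegative numbers does not depend on the basis.) -/
def IsTraceClass {H : Type*} [NormedAddCommGroup H] [InnerProductSpace ℂ H] [CompleteSpace H]
    (A : H →L[ℂ] H) : Prop :=
  ∃ (w : Set H) (e : HilbertBasis w ℂ H),
    Summable fun i : w => (inner ℂ (e i) (CFC.abs A (e i))).re

/-- `A` is of trace class and its trace is `t`: for every orthonormal basis `(eᵢ)`, the series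
`∑ ⟨A eᵢ, eᵢ⟩` converges unconditionally to `t`. (Mathlib's inner product is linear in its second
argument.) -/
def HasTrace {H : Type*} [NormedAddCommGroup H] [InnerProductSpace ℂ H] [CompleteSpace H]
    (A : H →L[ℂ] H) (t : ℂ) : Prop :=
  IsTraceClass A ∧
    ∀ (w : Set H) (e : HilbertBasis w ℂ H), HasSum (fun i : w => inner ℂ (e i) (A (e i))) t

/-- `ξ` is a spectral shift function for the pair `{T₁, T₀}`: it is integrable on the unit circle
and `trace ((T₁ - λ)⁻¹ - (T₀ - λ)⁻¹) = - ∫_𝕋 ξ(ζ) (ζ - λ)⁻² dζ` whenever `|λ| > 1`.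
Only the values of `ξ` on the unit circle matter. For contractions and `|λ| > 1` the operators
`Tⱼ - λ` are invertible, so that `Ring.inverse` is the true inverse. -/
def IsSpectralShiftFunction {H : Type*} [NormedAddCommGroup H] [InnerProductSpace ℂ H]
    [CompleteSpace H] (T₁ T₀ : H →L[ℂ] H) (ξ : ℂ → ℂ) : Prop :=
  CircleIntegrable ξ 0 1 ∧
    ∀ l : ℂ, 1 < ‖l‖ →
      HasTrace (Ring.inverse (T₁ - l • ContinuousLinearMap.id ℂ H) -
          Ring.inverse (T₀ - l • ContinuousLinearMap.id ℂ H))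
        (-∮ z in C(0, 1), ξ z / (z - l) ^ 2)

/-- The pair `{T₁, T₀}` has a real-valued spectral shift function. -/
def HasRealSpectralShiftFunction {H : Type*} [NormedAddCommGroup H] [InnerProductSpace ℂ H]
    [CompleteSpace H] (T₁ T₀ : H →L[ℂ] H) : Prop :=
  ∃ η : ℂ → ℝ, IsSpectralShiftFunction T₁ T₀ (fun z => (η z : ℂ))

/-- The condition `(Im ξ) log (1 + |Im ξ|) ∈ L¹(𝕋)`. -/
def ImLogIntegrable (ξ : ℂ → ℂ) : Prop :=
  CircleIntegrable (fun z => (ξ z).im * Real.log (1 + |(ξ z).im|)) 0 1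

/-!
The operators enter only through the trace formula. The trace is unique, so the difference `D` of
two spectral shift functions satisfies `∮ D(ζ) (ζ - λ)⁻² dζ = 0` for `|λ| > 1`; expanding in powers
of `1 / λ`, this says exactly that `D` lies in the Hardy class `H¹(𝕋)`
(`IsSpectralShiftFunction.isHardy_sub`, `IsSpectralShiftFunction.of_isHardy_sub`). Hence a
real-valued spectral shift function exists if and only if `Im ξ` is the real part of a function in
`H¹(𝕋)`, and the two claims are Zygmund's theorem (`exists_isHardy_re_eq`: a function of class
`L log L` is such a real part) and its converse for nonnegative functions
(`IsHardy.integrable_re_mul_log`).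

Both rest on one identity. If `q` is a polynomial with `Re q ≥ 0` on the circle, then `log (1 + q)`
belongs to the disc algebra, and `∫ f log (1 + q) = log (1 + q(0)) ∫ f` for `f ∈ H¹`
(`IsHardy.integral_mul_eq`).

* For the converse, take the real part. As `|arg (1 + q)| ≤ π / 2`, this bounds
  `∫ Re f · log (1 + Re q)` in terms of `‖f‖₁` and `q(0)`. Let `Re q` tend to `Re f` in `L¹` and
  apply Fatou's lemma.
* For Zygmund's theorem, take `f = q` with `q(0)` real. The right-hand side is nonnegative, so that
  `∫ Im q · arg (1 + q) ≤ ∫ Re q · log |1 + q|`. The left-hand side dominates `∫ |Im q|` up to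
  simple terms, and Young's inequality turns the right-hand side into
  `∫ Re q · log (1 + Re q) + ¼ ∫ |Im q|` up to simple terms. This bounds `‖q‖₁`
  (`exists_integral_norm_eval_le`), first for `Re q ≥ 0`, then for all `q` by splitting. Real parts
  of polynomials are dense in `L log L` (`exists_re_eval_zygmundWeight_le`), and the inequality,
  applied to large multiples of differences of approximants, shows that the polynomials converge
  in `L¹`.
-/

open Filter Topology Polynomial

/-! ### The circle and the Hardy class -/

/-- Lebesgue measure on `(0, 2π]`, by which the unit circle is parametrized. -/
noncomputable def angleMeasure : Measure ℝ := volume.restrict (Set.Ioc 0 (2 * Real.pi))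

instance : IsFiniteMeasure angleMeasure := by
  unfold angleMeasure; infer_instance

theorem circleIntegrable_iff_integrable_angleMeasure {E : Type*} [NormedAddCommGroup E]
    {g : ℂ → E} :
    CircleIntegrable g 0 1 ↔ Integrable (fun θ => g (circleMap 0 1 θ)) angleMeasure := by
  unfold CircleIntegrable angleMeasure
  rw [intervalIntegrable_iff_integrableOn_Ioc_of_le (by positivity)]
  rfl

theorem circleIntegral_eq_integral_angleMeasure (g : ℂ → ℂ) :
    (∮ z in C(0, 1), g z) =
      ∫ θ, Complex.I * circleMap 0 1 θ * g (circleMap 0 1 θ) ∂angleMeasure := by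
  rw [circleIntegral, intervalIntegral.integral_of_le (by positivity)]
  simp [angleMeasure, mul_comm]

theorem norm_circleMap_zero_one (θ : ℝ) : ‖circleMap 0 1 θ‖ = 1 := by simp

theorem Continuous.integrable_angleMeasure {E : Type*} [NormedAddCommGroup E] {g : ℝ → E}
    (hg : Continuous g) : Integrable g angleMeasure :=
  (hg.integrableOn_Icc (a := 0) (b := 2 * Real.pi)).mono_set Set.Ioc_subset_Icc_self

theorem integral_angleMeasure_const (c : ℝ) : ∫ _, c ∂angleMeasure = 2 * Real.pi * c := by
  have h : (0 : ℝ) ≤ 2 * Real.pi := by positivity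
  simp [angleMeasure, h]

/-- The Hardy class `H¹(𝕋)`, in terms of the angle: integrable functions whose Fourier coefficients
of negative index vanish. -/
structure IsHardy (f : ℝ → ℂ) : Prop where
  integrable : Integrable f angleMeasure
  integral_mul_pow : ∀ k : ℕ, k ≠ 0 → ∫ θ, f θ * circleMap 0 1 θ ^ k ∂angleMeasure = 0

theorem IsHardy.const_mul {f : ℝ → ℂ} (hf : IsHardy f) (c : ℂ) : IsHardy fun θ => c * f θ where
  integrable := hf.integrable.const_mul c
  integral_mul_pow k hk := by
    simp only [mul_assoc]
    rw [integral_const_mul, hf.integral_mul_pow k hk, mul_zero]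

theorem integral_circleMap_pow {k : ℕ} (hk : k ≠ 0) :
    ∫ θ, circleMap 0 1 θ ^ k ∂angleMeasure = 0 := by
  have h := circleIntegral_eq_integral_angleMeasure (fun z => z ^ (k - 1))
  have h0 : (∮ z in C(0, 1), z ^ (k - 1)) = 0 :=
    Complex.circleIntegral_eq_zero_of_differentiable_on_off_countable zero_le_one
      Set.countable_empty (by fun_prop) (fun z _ => by fun_prop)
  rw [h0] at h
  have h2 : ∀ θ : ℝ, Complex.I * circleMap 0 1 θ * circleMap 0 1 θ ^ (k - 1) =
      Complex.I * circleMap 0 1 θ ^ k := fun θ => by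
    rw [mul_assoc, ← pow_succ', Nat.sub_add_cancel (Nat.one_le_iff_ne_zero.2 hk)]
  simp only [h2, integral_const_mul] at h
  simpa using h.symm

theorem continuous_eval_circleMap (q : ℂ[X]) : Continuous fun θ : ℝ => q.eval (circleMap 0 1 θ) :=
  q.continuous.comp (continuous_circleMap 0 1)

theorem isHardy_eval (q : ℂ[X]) : IsHardy fun θ => q.eval (circleMap 0 1 θ) where
  integrable := (continuous_eval_circleMap q).integrable_angleMeasure
  integral_mul_pow k hk := by
    simp only [Polynomial.eval_eq_sum_range, Finset.sum_mul]
    rw [integral_finsetSum _ fun i _ => Continuous.integrable_angleMeasure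
      (by have := continuous_circleMap 0 1; fun_prop)]
    refine Finset.sum_eq_zero fun i _ => ?_
    simp only [mul_assoc, ← pow_add]
    rw [integral_const_mul, integral_circleMap_pow (by omega), mul_zero]

/-- A function of class `H¹(𝕋)` pairs with a function of the disc algebra through the values at the
centre of the disc only. -/
theorem IsHardy.integral_mul_eq {f : ℝ → ℂ} (hf : IsHardy f) {G : ℂ → ℂ}
    (hG : DiffContOnCl ℂ G (Metric.ball 0 1)) :
    ∫ θ, f θ * G (circleMap 0 1 θ) ∂angleMeasure = G 0 * ∫ θ, f θ ∂angleMeasure := by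
  have hcont : ContinuousOn G (Metric.closedBall 0 1) := by
    simpa [closure_ball] using hG.continuousOn
  have hcm : Continuous (circleMap 0 1) := continuous_circleMap 0 1
  -- On a smaller circle the power series of `G` converges absolutely.
  have key : ∀ r : ℝ, 0 ≤ r → r < 1 →
      ∫ θ, f θ * G (r * circleMap 0 1 θ) ∂angleMeasure = G 0 * ∫ θ, f θ ∂angleMeasure := by
    intro r hr0 hr1
    lift r to NNReal using hr0
    have hps := hG.hasFPowerSeriesOnBall (R := 1) (by norm_num)
    set p := cauchyPowerSeries G 0 1 with hp
    have hp' : HasFPowerSeriesOnBall G p 0 1 := by simpa using hps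
    have hsum : Summable fun n : ℕ => ‖p n‖ * (r : ℝ) ^ n :=
      p.summable_norm_mul_pow (lt_of_lt_of_le (by exact_mod_cast hr1) hp'.r_le)
    have hterm : ∀ θ : ℝ, HasSum (fun n => f θ * (p.coeff n * (r * circleMap 0 1 θ) ^ n))
        (f θ * G (r * circleMap 0 1 θ)) := fun θ => by
      have hmem : (r : ℂ) * circleMap 0 1 θ ∈ Metric.eball (0 : ℂ) 1 := by
        rw [mem_eball_zero_iff, enorm_mul]
        simpa [← ofReal_norm, ENNReal.ofReal_lt_one] using hr1
      have := hp'.hasSum hmem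
      simp only [FormalMultilinearSeries.apply_eq_pow_smul_coeff, zero_add, smul_eq_mul] at this
      simpa only [mul_comm (p.coeff _)] using this.mul_left (f θ)
    have hint : ∀ n, Integrable (fun θ => f θ * (p.coeff n * (r * circleMap 0 1 θ) ^ n))
        angleMeasure := fun n => by
      refine hf.integrable.mul_bdd (c := ‖p.coeff n‖ * (r : ℝ) ^ n)
        (by fun_prop : Continuous _).aestronglyMeasurable (ae_of_all _ fun θ => ?_)
      simp
    have hs := hasSum_integral_of_summable_integral_norm hint (by
      refine (hsum.mul_left (∫ θ, ‖f θ‖ ∂angleMeasure)).congr fun n => ?_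
      rw [← integral_mul_const]
      refine integral_congr_ae (ae_of_all _ fun θ => ?_)
      simp [FormalMultilinearSeries.norm_apply_eq_norm_coef])
    simp only [fun θ => (hterm θ).tsum_eq] at hs
    refine hs.unique ?_
    have hz : ∀ n, n ≠ 0 →
        ∫ θ, f θ * (p.coeff n * (r * circleMap 0 1 θ) ^ n) ∂angleMeasure = 0 := fun n hn => by
      have : ∀ θ : ℝ, f θ * (p.coeff n * (r * circleMap 0 1 θ) ^ n) =
          (p.coeff n * r ^ n) * (f θ * circleMap 0 1 θ ^ n) := fun θ => by ring
      simp only [this]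
      rw [integral_const_mul, hf.integral_mul_pow n hn, mul_zero]
    have h0 : p.coeff 0 = G 0 := by
      exact hp'.coeff_zero 1
    convert! hasSum_single 0 hz using 1
    simp only [pow_zero, mul_one, h0]
    rw [integral_mul_const, mul_comm]
  obtain ⟨C, hC⟩ := (isCompact_closedBall (0 : ℂ) 1).exists_bound_of_continuousOn hcont
  have hrn : ∀ n : ℕ, (0 : ℝ) ≤ 1 - 1 / ((n : ℝ) + 1) ∧ 1 - 1 / ((n : ℝ) + 1) < 1 := fun n => by
    have h1 : (0 : ℝ) < 1 / ((n : ℝ) + 1) := by positivity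
    have h2 : 1 / ((n : ℝ) + 1) ≤ 1 := by
      rw [div_le_one (by positivity)]; linarith [(Nat.cast_nonneg n : (0 : ℝ) ≤ n)]
    constructor <;> linarith
  have hrmem : ∀ (n : ℕ) (θ : ℝ), ((1 - 1 / ((n : ℝ) + 1) : ℝ) : ℂ) * circleMap 0 1 θ ∈
      Metric.closedBall (0 : ℂ) 1 := fun n θ => by
    rw [mem_closedBall_zero_iff, norm_mul, norm_circleMap_zero_one, mul_one, Complex.norm_real,
      Real.norm_of_nonneg (hrn n).1]
    exact (hrn n).2.le
  have hlim : Tendsto (fun n : ℕ => ∫ θ, f θ *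
      G (((1 - 1 / ((n : ℝ) + 1) : ℝ) : ℂ) * circleMap 0 1 θ) ∂angleMeasure) atTop
      (𝓝 (∫ θ, f θ * G (circleMap 0 1 θ) ∂angleMeasure)) := by
    refine tendsto_integral_of_dominated_convergence (fun θ => ‖f θ‖ * C) (fun n => ?_)
      (hf.integrable.norm.mul_const C) (fun n => ae_of_all _ fun θ => ?_)
      (ae_of_all _ fun θ => ?_)
    · exact hf.integrable.aestronglyMeasurable.mul (hcont.comp_continuous (by fun_prop)
        (hrmem n)).aestronglyMeasurable
    · rw [norm_mul]
      exact mul_le_mul_of_nonneg_left (hC _ (hrmem n θ)) (norm_nonneg _)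
    · refine Tendsto.const_mul _ ?_
      have h1 : ContinuousWithinAt G (Metric.closedBall 0 1) (circleMap 0 1 θ) :=
        hcont _ (by simp)
      refine h1.tendsto.comp (tendsto_nhdsWithin_iff.2 ⟨?_, Eventually.of_forall fun n => hrmem n θ⟩)
      have h2 : Tendsto (fun n : ℕ => ((1 - 1 / ((n : ℝ) + 1) : ℝ) : ℂ)) atTop (𝓝 ((1 : ℝ) : ℂ)) := by
        refine (Complex.continuous_ofReal.tendsto _).comp ?_
        simpa using tendsto_one_div_add_atTop_nhds_zero_nat.const_sub (1 : ℝ)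
      simpa using h2.mul_const (circleMap 0 1 θ)
  exact tendsto_nhds_unique hlim
    (tendsto_const_nhds.congr fun n => (key _ (hrn n).1 (hrn n).2).symm)

/-- The minimum principle for the real part of a polynomial. -/
theorem re_eval_nonneg_of_circleMap {q : ℂ[X]} (h : ∀ θ : ℝ, 0 ≤ (q.eval (circleMap 0 1 θ)).re)
    {z : ℂ} (hz : ‖z‖ ≤ 1) : 0 ≤ (q.eval z).re := by
  have hd : Differentiable ℂ fun z => Complex.exp (-q.eval z) := by fun_prop
  have := Complex.norm_le_of_forall_mem_frontier_norm_le (U := Metric.ball (0 : ℂ) 1)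
    Metric.isBounded_ball (f := fun z => Complex.exp (-q.eval z)) hd.diffContOnCl (C := 1)
    (fun w hw => by
      rw [frontier_ball _ one_ne_zero, mem_sphere_zero_iff_norm] at hw
      have hw' : circleMap 0 1 w.arg = w := by simp [circleMap, ← hw]
      have := h w.arg
      rw [hw'] at this
      simpa [Complex.norm_exp] using this)
    (z := z) (by simpa [closure_ball] using hz)
  simpa [Complex.norm_exp] using this

theorem diffContOnCl_log_one_add_eval {q : ℂ[X]}
    (h : ∀ θ : ℝ, 0 ≤ (q.eval (circleMap 0 1 θ)).re) :
    DiffContOnCl ℂ (fun z => Complex.log (1 + q.eval z)) (Metric.ball 0 1) := by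
  have hs : ∀ z ∈ Metric.closedBall (0 : ℂ) 1, 1 + q.eval z ∈ Complex.slitPlane := fun z hz => by
    have := re_eval_nonneg_of_circleMap h (mem_closedBall_zero_iff.1 hz)
    refine Or.inl ?_
    simp only [Complex.add_re, Complex.one_re]
    linarith
  refine DifferentiableOn.diffContOnCl ?_
  rw [closure_ball _ one_ne_zero]
  exact DifferentiableOn.clog (by fun_prop) hs

/-! ### Approximation by real parts of polynomials -/

instance fact_two_pi_pos : Fact (0 < 2 * Real.pi) := ⟨Real.two_pi_pos⟩

theorem fourier_two_pi_coe (n : ℤ) (θ : ℝ) :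
    fourier n (θ : AddCircle (2 * Real.pi)) = circleMap 0 1 θ ^ n := by
  rw [fourier_coe_apply, circleMap, Complex.ofReal_one, one_mul, zero_add, ← Complex.exp_int_mul]
  congr 1
  have : (Real.pi : ℂ) ≠ 0 := by exact_mod_cast Real.pi_ne_zero
  push_cast
  field_simp

theorem exists_re_eval_eq_of_mem_span_fourier {h : C(AddCircle (2 * Real.pi), ℂ)}
    (hh : h ∈ Submodule.span ℂ (Set.range (fourier (T := 2 * Real.pi)))) :
    ∃ q : ℂ[X], ∀ θ : ℝ, (q.eval (circleMap 0 1 θ)).re = (h θ).re := by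
  suffices H : ∀ a : ℂ, ∃ q : ℂ[X], ∀ θ : ℝ, (q.eval (circleMap 0 1 θ)).re = (a * h θ).re by
    simpa using H 1
  induction hh using Submodule.span_induction with
  | mem x hx =>
    obtain ⟨n, rfl⟩ := hx
    intro a
    obtain ⟨m, rfl | rfl⟩ := n.eq_nat_or_neg
    · exact ⟨C a * X ^ m, fun θ => by simp only [fourier_two_pi_coe]; simp⟩
    · refine ⟨C (starRingEnd ℂ a) * X ^ m, fun θ => ?_⟩
      -- On the circle, negative powers are the conjugates of the positive ones.
      have hinv : (circleMap 0 1 θ)⁻¹ = starRingEnd ℂ (circleMap 0 1 θ) :=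
        Complex.inv_eq_conj (norm_circleMap_zero_one θ)
      rw [fourier_two_pi_coe, zpow_neg, zpow_natCast, ← inv_pow, hinv, ← Complex.conj_re]
      simp
  | zero => exact fun _ => ⟨0, by simp⟩
  | add x y _ _ hx hy =>
    intro a
    obtain ⟨q, hq⟩ := hx a
    obtain ⟨r, hr⟩ := hy a
    exact ⟨q + r, fun θ => by simp [hq, hr, mul_add]⟩
  | smul b x _ hx =>
    intro a
    obtain ⟨q, hq⟩ := hx (a * b)
    exact ⟨q, fun θ => by rw [hq]; simp [mul_assoc]⟩

/-- Real parts of polynomials are uniformly dense in the real continuous functions on the circle.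
The normalization `Im q(0) = 0` costs nothing, as an imaginary constant does not affect `Re q`. -/
theorem exists_re_eval_near (g : C(AddCircle (2 * Real.pi), ℝ)) {ε : ℝ} (hε : 0 < ε) :
    ∃ q : ℂ[X], (q.eval 0).im = 0 ∧ ∀ θ : ℝ, |(q.eval (circleMap 0 1 θ)).re - g θ| < ε := by
  let G : C(AddCircle (2 * Real.pi), ℂ) := ⟨fun x => (g x : ℂ), by fun_prop⟩
  have hG : G ∈ (Submodule.span ℂ (Set.range
      (fourier (T := 2 * Real.pi)))).topologicalClosure := by
    rw [span_fourier_closure_eq_top]; trivial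
  obtain ⟨h, hh, hd⟩ := Metric.mem_closure_iff.1 hG ε hε
  obtain ⟨q, hq⟩ := exists_re_eval_eq_of_mem_span_fourier hh
  refine ⟨q - C ((q.eval 0).im * Complex.I), by simp, fun θ => ?_⟩
  have h1 : dist (G θ) (h θ) < ε := (ContinuousMap.dist_apply_le_dist _).trans_lt hd
  have h2 := Complex.abs_re_le_norm (h θ - G θ)
  rw [dist_comm, Complex.dist_eq] at h1
  simp only [eval_sub, eval_C, Complex.sub_re, hq]
  simpa [G] using h2.trans_lt h1

theorem exists_continuous_integral_rpow_sub_le {v : ℝ → ℝ} {p : ℝ} (hp : 0 < p)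
    (hv : MemLp v (ENNReal.ofReal p) angleMeasure) {ε : ℝ} (hε : 0 < ε) :
    ∃ g : C(AddCircle (2 * Real.pi), ℝ), ∫ θ, ‖v θ - g θ‖ ^ p ∂angleMeasure ≤ ε := by
  have hV : MemLp (AddCircle.liftIoc (2 * Real.pi) 0 v) (ENNReal.ofReal p) volume := by
    have hv' : MemLp v (ENNReal.ofReal p) (volume.restrict (Set.Ioc 0 (0 + 2 * Real.pi))) := by
      rw [zero_add]; exact hv
    simp only [AddCircle.liftIoc, Set.domRestrict_def, Function.comp_def]
    exact hv'.comp_measurePreserving ((measurePreserving_subtype_coe measurableSet_Ioc).comp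
      (AddCircle.measurePreserving_equivIoc _))
  obtain ⟨g, hg, -⟩ := hV.exists_boundedContinuous_integral_rpow_sub_le hp hε
  refine ⟨g.toContinuousMap, ?_⟩
  rw [← AddCircle.integral_preimage (2 * Real.pi) 0, zero_add] at hg
  refine le_of_eq_of_le (setIntegral_congr_fun measurableSet_Ioc fun θ hθ => ?_) hg
  rw [AddCircle.liftIoc_zero_coe_apply hθ]
  rfl

theorem continuous_comp_addCircle_coe (g : C(AddCircle (2 * Real.pi), ℝ)) :
    Continuous fun θ : ℝ => g θ :=
  g.continuous.comp (AddCircle.continuous_mk' _)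

theorem exists_re_eval_nonneg_integral_abs_sub_le {v : ℝ → ℝ} (hv : Integrable v angleMeasure)
    (h0 : ∀ᵐ θ ∂angleMeasure, 0 ≤ v θ) {ε : ℝ} (hε : 0 < ε) :
    ∃ q : ℂ[X], (q.eval 0).im = 0 ∧ (∀ θ : ℝ, 0 ≤ (q.eval (circleMap 0 1 θ)).re) ∧
      ∫ θ, |v θ - (q.eval (circleMap 0 1 θ)).re| ∂angleMeasure ≤ ε := by
  obtain ⟨g, hg⟩ := exists_continuous_integral_rpow_sub_le one_pos
    (by simpa using memLp_one_iff_integrable.2 hv) (half_pos hε)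
  simp only [Real.rpow_one, Real.norm_eq_abs] at hg
  -- Adding `δ` to the positive part of `g` keeps a `δ`-approximation by `Re q` nonnegative.
  set δ := ε / (8 * Real.pi) with hδ
  have hδ0 : 0 < δ := by positivity
  obtain ⟨q, hq0, hq⟩ := exists_re_eval_near
    ⟨fun x => max (g x) 0 + δ, by fun_prop⟩ hδ0
  simp only [ContinuousMap.coe_mk, abs_lt] at hq
  refine ⟨q, hq0, fun θ => ?_, ?_⟩
  · linarith [(hq θ).1, le_max_right (g θ) 0]
  · have hcq : Continuous fun θ : ℝ => (q.eval (circleMap 0 1 θ)).re :=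
      Complex.continuous_re.comp (continuous_eval_circleMap q)
    have hi : Integrable (fun θ => v θ - g θ) angleMeasure :=
      hv.sub (continuous_comp_addCircle_coe g).integrable_angleMeasure
    calc ∫ θ, |v θ - (q.eval (circleMap 0 1 θ)).re| ∂angleMeasure
        ≤ ∫ θ, (|v θ - g θ| + 2 * δ) ∂angleMeasure := by
          refine integral_mono_ae (hv.sub hcq.integrable_angleMeasure).abs
            (hi.abs.add (integrable_const _)) ?_
          filter_upwards [h0] with θ hθ
          have h1 := hq θ
          have h2 : |v θ - max (g θ) 0| ≤ |v θ - g θ| := by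
            simpa [max_eq_left hθ] using abs_max_sub_max_le_abs (v θ) (g θ) 0
          have h3 : |max (g θ) 0 - (q.eval (circleMap 0 1 θ)).re| ≤ 2 * δ := by
            rw [abs_le]; constructor <;> linarith
          exact (abs_sub_le _ (max (g θ) 0) _).trans (add_le_add h2 h3)
      _ = (∫ θ, |v θ - g θ| ∂angleMeasure) + 2 * Real.pi * (2 * δ) := by
          rw [integral_add hi.abs (integrable_const _), integral_angleMeasure_const]
      _ ≤ ε / 2 + ε / 2 := by
          refine add_le_add hg (le_of_eq ?_)
          rw [hδ]
          field_simp
          norm_num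
      _ = ε := add_halves ε

theorem exists_re_eval_integral_sq_sub_le {v : ℝ → ℝ} (hv : MemLp v 2 angleMeasure) {ε : ℝ}
    (hε : 0 < ε) :
    ∃ q : ℂ[X], (q.eval 0).im = 0 ∧
      ∫ θ, (v θ - (q.eval (circleMap 0 1 θ)).re) ^ 2 ∂angleMeasure ≤ ε := by
  obtain ⟨g, hg⟩ := exists_continuous_integral_rpow_sub_le two_pos
    (by simpa using hv) (ε := ε / 4) (by positivity)
  simp only [Real.rpow_two, Real.norm_eq_abs, sq_abs] at hg
  obtain ⟨q, hq0, hq⟩ := exists_re_eval_near g (ε := √(ε / (8 * Real.pi))) (by positivity)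
  refine ⟨q, hq0, ?_⟩
  have hcq : Continuous fun θ : ℝ => (q.eval (circleMap 0 1 θ)).re :=
    Complex.continuous_re.comp (continuous_eval_circleMap q)
  have hmem : ∀ {h : ℝ → ℝ}, Continuous h → MemLp h 2 angleMeasure := fun {h} hh =>
    (memLp_two_iff_integrable_sq hh.aestronglyMeasurable).2 (hh.pow 2).integrable_angleMeasure
  have hi : Integrable (fun θ => (v θ - g θ) ^ 2) angleMeasure :=
    (hv.sub (hmem (continuous_comp_addCircle_coe g))).integrable_sq
  calc ∫ θ, (v θ - (q.eval (circleMap 0 1 θ)).re) ^ 2 ∂angleMeasure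
      ≤ ∫ θ, (2 * (v θ - g θ) ^ 2 + 2 * (ε / (8 * Real.pi))) ∂angleMeasure := by
        refine integral_mono (hv.sub (hmem hcq)).integrable_sq
          ((hi.const_mul 2).add (integrable_const _)) fun θ => ?_
        have h1 : ((q.eval (circleMap 0 1 θ)).re - g θ) ^ 2 ≤ ε / (8 * Real.pi) := by
          rw [← sq_abs]
          exact (pow_le_pow_left₀ (abs_nonneg _) (hq θ).le 2).trans
            (Real.sq_sqrt (by positivity)).le
        simp only
        nlinarith [sq_nonneg ((v θ - g θ) + ((q.eval (circleMap 0 1 θ)).re - g θ))]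
    _ = 2 * (∫ θ, (v θ - g θ) ^ 2 ∂angleMeasure) + 2 * Real.pi * (2 * (ε / (8 * Real.pi))) := by
        rw [integral_add (hi.const_mul 2) (integrable_const _), integral_angleMeasure_const,
          integral_const_mul]
    _ ≤ 2 * (ε / 4) + ε / 2 := by
        refine add_le_add (by linarith) (le_of_eq ?_)
        field_simp
        norm_num
    _ = ε := by ring

/-! ### Nonnegative real parts of functions in the Hardy class -/

theorem Complex.abs_arg_one_add_le {w : ℂ} (hw : 0 ≤ w.re) :
    |Complex.arg (1 + w)| ≤ Real.pi / 2 :=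
  Complex.abs_arg_le_pi_div_two_iff.2 (by simp; linarith)

theorem Complex.log_one_add_re_le {w : ℂ} (hw : 0 ≤ w.re) :
    Real.log (1 + w.re) ≤ Real.log ‖1 + w‖ :=
  Real.log_le_log (by linarith) (by simpa using Complex.re_le_norm (1 + w))

theorem continuous_log_one_add_eval {q : ℂ[X]}
    (h : ∀ θ : ℝ, 0 ≤ (q.eval (circleMap 0 1 θ)).re) :
    Continuous fun θ : ℝ => Complex.log (1 + q.eval (circleMap 0 1 θ)) :=
  (continuous_const.add (continuous_eval_circleMap q)).clog fun θ =>
    Or.inl (by simpa using by linarith [h θ])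

theorem integral_re_eval_circleMap (q : ℂ[X]) :
    ∫ θ, (q.eval (circleMap 0 1 θ)).re ∂angleMeasure = 2 * Real.pi * (q.eval 0).re := by
  have h1 : IsHardy fun _ => 1 := by simpa using isHardy_eval 1
  have h2 := h1.integral_mul_eq (G := fun z => q.eval z) q.differentiable.diffContOnCl
  have h3 := integral_re (isHardy_eval q).integrable
  simp only [one_mul] at h2
  simp only [RCLike.re_to_complex] at h3
  rw [h3, h2]
  simp [angleMeasure, Real.pi_pos.le, mul_comm]

theorem IsHardy.integrable_mul_log {f : ℝ → ℂ} (hf : IsHardy f) {q : ℂ[X]}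
    (hq : ∀ θ : ℝ, 0 ≤ (q.eval (circleMap 0 1 θ)).re) :
    Integrable (fun θ => f θ * Complex.log (1 + q.eval (circleMap 0 1 θ))) angleMeasure := by
  obtain ⟨C, hC⟩ := (isCompact_closedBall (0 : ℂ) 1).exists_bound_of_continuousOn
    (f := fun z => Complex.log (1 + q.eval z))
    (by simpa [closure_ball] using (diffContOnCl_log_one_add_eval hq).continuousOn)
  exact hf.integrable.mul_bdd (c := C) (continuous_log_one_add_eval hq).aestronglyMeasurable
    (ae_of_all _ fun θ => hC _ (by simp))

theorem IsHardy.integral_re_mul_log_eq {f : ℝ → ℂ} (hf : IsHardy f) {q : ℂ[X]}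
    (hq0 : (q.eval 0).im = 0) (hq : ∀ θ : ℝ, 0 ≤ (q.eval (circleMap 0 1 θ)).re) :
    ∫ θ, (f θ * Complex.log (1 + q.eval (circleMap 0 1 θ))).re ∂angleMeasure =
      Real.log (1 + (q.eval 0).re) * ∫ θ, (f θ).re ∂angleMeasure := by
  have h1 := hf.integral_mul_eq (diffContOnCl_log_one_add_eval hq)
  have h2 := integral_re (hf.integrable_mul_log hq)
  have h3 := integral_re hf.integrable
  simp only [RCLike.re_to_complex] at h2 h3
  have h4 : 0 ≤ (q.eval 0).re := re_eval_nonneg_of_circleMap hq (by simp)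
  have h5 : 1 + q.eval 0 = ((1 + (q.eval 0).re : ℝ) : ℂ) := by
    apply Complex.ext <;> simp [hq0]
  rw [h2, h1, h3, h5, ← Complex.ofReal_log (by linarith), Complex.re_ofReal_mul]

/-- Testing `f` against `log (1 + q)`, whose imaginary part is bounded by `π / 2`. -/
theorem IsHardy.integral_re_mul_log_le {f : ℝ → ℂ} (hf : IsHardy f)
    (hf0 : ∀ᵐ θ ∂angleMeasure, 0 ≤ (f θ).re) {q : ℂ[X]} (hq0 : (q.eval 0).im = 0)
    (hq : ∀ θ : ℝ, 0 ≤ (q.eval (circleMap 0 1 θ)).re) :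
    Integrable (fun θ => (f θ).re * Real.log (1 + (q.eval (circleMap 0 1 θ)).re)) angleMeasure ∧
    ∫ θ, (f θ).re * Real.log (1 + (q.eval (circleMap 0 1 θ)).re) ∂angleMeasure ≤
      Real.log (1 + (q.eval 0).re) * (∫ θ, (f θ).re ∂angleMeasure) +
        Real.pi / 2 * ∫ θ, ‖f θ‖ ∂angleMeasure := by
  have hlog := hf.integrable_mul_log hq
  have hcq : Continuous fun θ : ℝ => (q.eval (circleMap 0 1 θ)).re :=
    Complex.continuous_re.comp (continuous_eval_circleMap q)
  have hbound : ∀ᵐ θ ∂angleMeasure,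
      (f θ).re * Real.log (1 + (q.eval (circleMap 0 1 θ)).re) ≤
        (f θ * Complex.log (1 + q.eval (circleMap 0 1 θ))).re + Real.pi / 2 * ‖f θ‖ := by
    filter_upwards [hf0] with θ hθ
    rw [Complex.mul_re, Complex.log_re, Complex.log_im]
    have h1 := mul_le_mul_of_nonneg_left (Complex.log_one_add_re_le (hq θ)) hθ
    have h2 : (f θ).im * Complex.arg (1 + q.eval (circleMap 0 1 θ)) ≤ Real.pi / 2 * ‖f θ‖ := by
      refine (le_abs_self _).trans ?_
      rw [abs_mul, mul_comm]
      exact mul_le_mul (Complex.abs_arg_one_add_le (hq θ)) (Complex.abs_im_le_norm _)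
        (abs_nonneg _) (by positivity)
    linarith
  have hre : Integrable (fun θ => (f θ * Complex.log (1 + q.eval (circleMap 0 1 θ))).re)
      angleMeasure := hlog.re
  have hR : Integrable (fun θ => (f θ * Complex.log (1 + q.eval (circleMap 0 1 θ))).re +
      Real.pi / 2 * ‖f θ‖) angleMeasure := hre.add (hf.integrable.norm.const_mul _)
  have hL : Integrable (fun θ => (f θ).re * Real.log (1 + (q.eval (circleMap 0 1 θ)).re))
      angleMeasure := by
    refine hR.mono' (hf.integrable.re.aestronglyMeasurable.mul
      (Continuous.log (by fun_prop) fun θ => by linarith [hq θ]).aestronglyMeasurable) ?_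
    filter_upwards [hbound, hf0] with θ h1 h2
    rwa [Real.norm_of_nonneg (mul_nonneg h2 (Real.log_nonneg (by linarith [hq θ])))]
  refine ⟨hL, (integral_mono_ae hL hR hbound).trans_eq ?_⟩
  rw [integral_add hre (hf.integrable.norm.const_mul _), integral_const_mul,
    hf.integral_re_mul_log_eq hq0 hq]

/-- The converse of Zygmund's theorem for nonnegative functions. -/
theorem IsHardy.integrable_re_mul_log {f : ℝ → ℂ} (hf : IsHardy f)
    (hf0 : ∀ᵐ θ ∂angleMeasure, 0 ≤ (f θ).re) :
    Integrable (fun θ => (f θ).re * Real.log (1 + (f θ).re)) angleMeasure := by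
  have hv : Integrable (fun θ => (f θ).re) angleMeasure := hf.integrable.re
  choose q hq0 hq hqv using fun n : ℕ =>
    exists_re_eval_nonneg_integral_abs_sub_le hv hf0 (ε := 1 / ((n : ℝ) + 1)) (by positivity)
  have hcq : ∀ n, Continuous fun θ : ℝ => ((q n).eval (circleMap 0 1 θ)).re := fun n =>
    Complex.continuous_re.comp (continuous_eval_circleMap _)
  -- The means of the approximating polynomials are bounded.
  have hmean : ∀ n, ((q n).eval 0).re ≤ (∫ θ, (f θ).re ∂angleMeasure) + 1 := fun n => by
    have h1 := integral_re_eval_circleMap (q n)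
    have h2 : ∫ θ, ((q n).eval (circleMap 0 1 θ)).re ∂angleMeasure ≤
        (∫ θ, (f θ).re ∂angleMeasure) +
          ∫ θ, |(f θ).re - ((q n).eval (circleMap 0 1 θ)).re| ∂angleMeasure := by
      have hi : Integrable (fun θ => |(f θ).re - ((q n).eval (circleMap 0 1 θ)).re|)
          angleMeasure := (hv.sub (hcq n).integrable_angleMeasure).abs
      rw [← integral_add hv hi]
      refine integral_mono (hcq n).integrable_angleMeasure (hv.add hi) fun θ => ?_
      have := neg_abs_le ((f θ).re - ((q n).eval (circleMap 0 1 θ)).re)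
      simp only
      linarith
    have h3 : 1 / ((n : ℝ) + 1) ≤ 1 := by
      rw [div_le_one (by positivity)]; linarith [(Nat.cast_nonneg n : (0 : ℝ) ≤ n)]
    have h4 : 0 ≤ ((q n).eval 0).re := re_eval_nonneg_of_circleMap (hq n) (by simp)
    nlinarith [Real.pi_gt_three, hqv n]
  have hv0 : 0 ≤ ∫ θ, (f θ).re ∂angleMeasure := integral_nonneg_of_ae hf0
  set C := Real.log (1 + ((∫ θ, (f θ).re ∂angleMeasure) + 1)) * (∫ θ, (f θ).re ∂angleMeasure) +
    Real.pi / 2 * ∫ θ, ‖f θ‖ ∂angleMeasure with hC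
  have hle : ∀ n, ∫⁻ θ, ENNReal.ofReal ((f θ).re *
      Real.log (1 + ((q n).eval (circleMap 0 1 θ)).re)) ∂angleMeasure ≤ ENNReal.ofReal C := by
    intro n
    obtain ⟨hi, hb⟩ := hf.integral_re_mul_log_le hf0 (hq0 n) (hq n)
    rw [← ofReal_integral_eq_lintegral_ofReal hi ?_]
    · refine ENNReal.ofReal_le_ofReal (hb.trans ?_)
      have h4 : 0 ≤ ((q n).eval 0).re := re_eval_nonneg_of_circleMap (hq n) (by simp)
      have := Real.log_le_log (by linarith) (add_le_add_right (hmean n) 1)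
      rw [hC]
      gcongr
    · filter_upwards [hf0] with θ hθ
      exact mul_nonneg hθ (Real.log_nonneg (by linarith [hq n θ]))
  have hconv : TendstoInMeasure angleMeasure
      (fun n θ => ((q n).eval (circleMap 0 1 θ)).re) atTop (fun θ => (f θ).re) := by
    refine tendstoInMeasure_of_tendsto_eLpNorm one_ne_zero
      (fun n => (hcq n).aestronglyMeasurable) hv.aestronglyMeasurable ?_
    refine tendsto_of_tendsto_of_tendsto_of_le_of_le tendsto_const_nhds
      (h := fun n : ℕ => ENNReal.ofReal (1 / ((n : ℝ) + 1))) ?_ (fun _ => zero_le) fun n => ?_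
    · simpa using ENNReal.tendsto_ofReal tendsto_one_div_add_atTop_nhds_zero_nat
    · have hi := (hcq n).integrable_angleMeasure.sub hv
      simp only
      rw [eLpNorm_one_eq_lintegral_enorm, ← ofReal_integral_norm_eq_lintegral_enorm hi]
      refine ENNReal.ofReal_le_ofReal (le_of_eq_of_le ?_ (hqv n))
      simp only [Pi.sub_apply, Real.norm_eq_abs, abs_sub_comm]
  obtain ⟨ns, -, hns⟩ := hconv.exists_seq_tendsto_ae
  have hmeas : AEMeasurable (fun θ => (f θ).re) angleMeasure := hv.aemeasurable
  refine ⟨(hmeas.mul (Real.measurable_log.comp_aemeasurable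
    (hmeas.const_add 1))).aestronglyMeasurable, ?_⟩
  rw [hasFiniteIntegral_iff_ofReal (by
    filter_upwards [hf0] with θ hθ
    exact mul_nonneg hθ (Real.log_nonneg (by linarith)))]
  have hfatou := lintegral_liminf_le' (μ := angleMeasure) (u := atTop) (f := fun k θ => ENNReal.ofReal
    ((f θ).re * Real.log (1 + ((q (ns k)).eval (circleMap 0 1 θ)).re))) fun k =>
      (hmeas.mul (Real.measurable_log.comp_aemeasurable
        ((hcq (ns k)).measurable.aemeasurable.const_add 1))).ennreal_ofReal
  have hlim : ∀ᵐ θ ∂angleMeasure, liminf (fun k => ENNReal.ofReal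
      ((f θ).re * Real.log (1 + ((q (ns k)).eval (circleMap 0 1 θ)).re))) atTop =
        ENNReal.ofReal ((f θ).re * Real.log (1 + (f θ).re)) := by
    filter_upwards [hns, hf0] with θ hθ hθ0
    refine (ENNReal.tendsto_ofReal (Tendsto.const_mul _ ?_)).liminf_eq
    exact (hθ.const_add 1).log (by linarith)
  rw [lintegral_congr_ae hlim] at hfatou
  refine (hfatou.trans ?_).trans_lt (ENNReal.ofReal_lt_top (r := C))
  exact liminf_le_of_frequently_le' (f := atTop) (Frequently.of_forall fun k => hle (ns k))

/-! ### The weight of the Zygmund class -/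

/-- The weight `x log (1 + x)` of the Zygmund class `L log L`, meant for `x ≥ 0`. -/
noncomputable def zygmundWeight (x : ℝ) : ℝ := x * Real.log (1 + x)

theorem zygmundWeight_nonneg {x : ℝ} (hx : 0 ≤ x) : 0 ≤ zygmundWeight x :=
  mul_nonneg hx (Real.log_nonneg (by linarith))

theorem zygmundWeight_mono {x y : ℝ} (hx : 0 ≤ x) (hxy : x ≤ y) :
    zygmundWeight x ≤ zygmundWeight y :=
  mul_le_mul hxy (Real.log_le_log (by linarith) (by linarith)) (Real.log_nonneg (by linarith))
    (hx.trans hxy)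

theorem zygmundWeight_add_le {x y : ℝ} (hx : 0 ≤ x) (hy : 0 ≤ y) :
    zygmundWeight (x + y) ≤ zygmundWeight (2 * x) + zygmundWeight (2 * y) := by
  rcases le_total x y with h | h
  · have := zygmundWeight_mono (x := x + y) (y := 2 * y) (by linarith) (by linarith)
    linarith [zygmundWeight_nonneg (x := 2 * x) (by linarith)]
  · have := zygmundWeight_mono (x := x + y) (y := 2 * x) (by linarith) (by linarith)
    linarith [zygmundWeight_nonneg (x := 2 * y) (by linarith)]

theorem zygmundWeight_le_sq {x : ℝ} (hx : 0 ≤ x) : zygmundWeight x ≤ x ^ 2 := by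
  have := Real.log_le_sub_one_of_pos (x := 1 + x) (by linarith)
  rw [sq]
  exact mul_le_mul_of_nonneg_left (by linarith) hx

theorem le_zygmundWeight_add_two {x : ℝ} (hx : 0 ≤ x) : x ≤ zygmundWeight x + 2 := by
  rcases le_total x 2 with h | h
  · linarith [zygmundWeight_nonneg hx]
  · have h1 : 1 ≤ Real.log (1 + x) := by
      rw [Real.le_log_iff_exp_le (by linarith)]
      linarith [Real.exp_one_lt_d9]
    have := mul_le_mul_of_nonneg_left h1 hx
    unfold zygmundWeight
    linarith

theorem zygmundWeight_mul_le {c x : ℝ} (hc : 1 ≤ c) (hx : 0 ≤ x) :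
    zygmundWeight (c * x) ≤ c * Real.log c * x + c * zygmundWeight x := by
  have h1 : Real.log (1 + c * x) ≤ Real.log c + Real.log (1 + x) := by
    rw [← Real.log_mul (by positivity) (by positivity)]
    exact Real.log_le_log (by positivity) (by linarith)
  calc c * x * Real.log (1 + c * x) ≤ c * x * (Real.log c + Real.log (1 + x)) :=
        mul_le_mul_of_nonneg_left h1 (by positivity)
    _ = _ := by unfold zygmundWeight; ring

theorem continuous_zygmundWeight_abs : Continuous fun x : ℝ => zygmundWeight |x| :=
  continuous_abs.mul (Continuous.log (by fun_prop) fun x => by positivity)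

theorem continuous_zygmundWeight_const_mul_abs {c : ℝ} (hc : 0 ≤ c) :
    Continuous fun x : ℝ => zygmundWeight (c * |x|) := by
  have h := continuous_zygmundWeight_abs.comp (continuous_const_mul c)
  simpa [Function.comp_def, abs_mul, abs_of_nonneg hc] using h

/-! ### The Hardy norm of a polynomial is controlled by its real part -/

theorem Real.abs_sub_one_le_mul_arctan (t : ℝ) : |t| - 1 ≤ t * Real.arctan t := by
  wlog ht : 0 ≤ t generalizing t
  · simpa using this (-t) (by linarith)
  rcases ht.eq_or_lt with rfl | ht
  · simp
  have h1 : Real.arctan t⁻¹ ≤ t⁻¹ := by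
    have := Real.le_tan (Real.arctan_nonneg.2 (inv_pos.2 ht).le) (Real.arctan_lt_pi_div_two t⁻¹)
    rwa [Real.tan_arctan] at this
  rw [Real.arctan_inv_of_pos ht] at h1
  have h2 : t * t⁻¹ = 1 := mul_inv_cancel₀ ht.ne'
  rw [abs_of_pos ht]
  nlinarith [Real.pi_gt_three, mul_le_mul_of_nonneg_left h1 ht.le]

theorem Complex.abs_im_le_im_mul_arg_add {w : ℂ} (hw : 0 ≤ w.re) :
    |w.im| ≤ w.im * Complex.arg (1 + w) + 1 + w.re := by
  have ha : 0 < 1 + w.re := by linarith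
  have harg : Complex.arg (1 + w) = Real.arctan (w.im / (1 + w.re)) := by
    have hlt := abs_lt.1 (Complex.abs_arg_lt_pi_div_two_iff.2
      (Or.inl (by simpa using ha) : 0 < (1 + w).re ∨ 1 + w = 0))
    have htan : Real.tan (Complex.arg (1 + w)) = w.im / (1 + w.re) := by
      simp [Complex.tan_arg]
    rw [← htan, Real.arctan_tan hlt.1 hlt.2]
  have h1 := mul_le_mul_of_nonneg_left (Real.abs_sub_one_le_mul_arctan (w.im / (1 + w.re))) ha.le
  rw [abs_div, abs_of_pos ha, mul_sub, mul_one, mul_div_cancel₀ _ ha.ne', ← mul_assoc,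
    mul_div_cancel₀ _ ha.ne'] at h1
  rw [harg]
  linarith

theorem Complex.re_mul_log_norm_le {w : ℂ} (hw : 0 ≤ w.re) :
    w.re * Real.log ‖1 + w‖ ≤ zygmundWeight w.re + 2 * w.re + (1 + w.re + |w.im|) / 4 := by
  have ha : 0 < 1 + w.re := by linarith
  have hn : 0 < ‖1 + w‖ := lt_of_lt_of_le ha (by simpa using Complex.re_le_norm (1 + w))
  have hn' : ‖1 + w‖ ≤ 1 + w.re + |w.im| := by
    have := Complex.norm_le_abs_re_add_abs_im (1 + w)
    simpa [abs_of_pos ha] using this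
  -- Young's inequality `u log b ≤ u log (1 + u) + b - u` at `b = ‖1 + w‖ / 4`.
  have h1 : Real.log ‖1 + w‖ = Real.log (‖1 + w‖ / 4 / (1 + w.re)) + Real.log (1 + w.re) +
      Real.log 4 := by
    rw [← Real.log_mul (by positivity) (by positivity), ← Real.log_mul (by positivity) (by norm_num)]
    congr 1
    field_simp
  have h2 := Real.log_le_sub_one_of_pos (x := ‖1 + w‖ / 4 / (1 + w.re)) (by positivity)
  have h3 := Real.log_le_sub_one_of_pos (x := 4) (by norm_num)
  have h4 : w.re * (‖1 + w‖ / 4 / (1 + w.re)) ≤ ‖1 + w‖ / 4 := by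
    rw [mul_div_assoc', div_le_iff₀ ha]
    nlinarith
  have h5 := mul_le_mul_of_nonneg_left h2 hw
  have h6 := mul_le_mul_of_nonneg_left h3 hw
  rw [h1]
  unfold zygmundWeight
  nlinarith

/-- Pointwise form of Zygmund's inequality: the first term has a nonpositive integral when `w` runs
over the boundary values of a polynomial with nonnegative real part. -/
theorem Complex.norm_le_zygmundWeight_re {w : ℂ} (hw : 0 ≤ w.re) :
    ‖w‖ ≤ -(4 / 3) * (w * Complex.log (1 + w)).re + 7 * zygmundWeight w.re + 13 := by
  have h1 := Complex.abs_im_le_im_mul_arg_add hw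
  have h2 := Complex.re_mul_log_norm_le hw
  have h3 := le_zygmundWeight_add_two hw
  have h4 := Complex.norm_le_abs_re_add_abs_im w
  have h5 := zygmundWeight_nonneg hw
  rw [abs_of_nonneg hw] at h4
  rw [Complex.mul_re, Complex.log_re, Complex.log_im]
  linarith

/-- Zygmund's inequality for a nonnegative real part: the identity
`Re ∫ q log (1 + q) = 2π q(0) log (1 + q(0)) ≥ 0` is combined with a pointwise estimate. -/
theorem integral_norm_eval_le_of_re_nonneg {q : ℂ[X]} (hq0 : (q.eval 0).im = 0)
    (hq : ∀ θ : ℝ, 0 ≤ (q.eval (circleMap 0 1 θ)).re) :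
    ∫ θ, ‖q.eval (circleMap 0 1 θ)‖ ∂angleMeasure ≤
      7 * (∫ θ, zygmundWeight (q.eval (circleMap 0 1 θ)).re ∂angleMeasure) + 26 * Real.pi := by
  have hH := isHardy_eval q
  have h0 : 0 ≤ (q.eval 0).re := re_eval_nonneg_of_circleMap hq (by simp)
  have hcq : Continuous fun θ : ℝ => (q.eval (circleMap 0 1 θ)).re :=
    Complex.continuous_re.comp (continuous_eval_circleMap q)
  have hl : Integrable (fun θ => -(4 / 3) * (q.eval (circleMap 0 1 θ) *
      Complex.log (1 + q.eval (circleMap 0 1 θ))).re) angleMeasure :=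
    (hH.integrable_mul_log hq).re.const_mul _
  have hΦ : Integrable (fun θ => 7 * zygmundWeight (q.eval (circleMap 0 1 θ)).re) angleMeasure := by
    refine Integrable.const_mul ?_ _
    refine (continuous_zygmundWeight_abs.comp hcq).integrable_angleMeasure.congr
      (ae_of_all _ fun θ => ?_)
    simp [abs_of_nonneg (hq θ)]
  have hlΦ : Integrable (fun θ => -(4 / 3) * (q.eval (circleMap 0 1 θ) *
      Complex.log (1 + q.eval (circleMap 0 1 θ))).re +
        7 * zygmundWeight (q.eval (circleMap 0 1 θ)).re) angleMeasure := hl.add hΦ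
  refine (integral_mono hH.integrable.norm (hlΦ.add (integrable_const 13))
    fun θ => Complex.norm_le_zygmundWeight_re (hq θ)).trans ?_
  simp only [Pi.add_apply]
  rw [integral_add hlΦ (integrable_const 13), integral_add hl hΦ, integral_const_mul,
    integral_const_mul, integral_angleMeasure_const, hH.integral_re_mul_log_eq hq0 hq,
    integral_re_eval_circleMap]
  have : 0 ≤ Real.log (1 + (q.eval 0).re) * (2 * Real.pi * (q.eval 0).re) :=
    mul_nonneg (Real.log_nonneg (by linarith)) (by positivity)
  linarith

/-- Zygmund's inequality for trigonometric polynomials. The case of a real part of varying sign is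
reduced to the case of a nonnegative one by writing `q = q₊ - q₋`, where `Re q₊` is close to
`(Re q)⁺ + 1`. -/
theorem exists_integral_norm_eval_le :
    ∃ C : ℝ, 0 < C ∧ ∀ q : ℂ[X], (q.eval 0).im = 0 →
      ∫ θ, ‖q.eval (circleMap 0 1 θ)‖ ∂angleMeasure ≤
        C * ((∫ θ, zygmundWeight (2 * |(q.eval (circleMap 0 1 θ)).re|) ∂angleMeasure) + 1) := by
  refine ⟨14 + 28 * Real.pi * zygmundWeight 4 + 52 * Real.pi, ?_, fun q hq0 => ?_⟩
  · have := zygmundWeight_nonneg (x := 4) (by norm_num)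
    positivity
  have hper : Function.Periodic (fun θ : ℝ => q.eval (circleMap 0 1 θ)) (2 * Real.pi) := fun θ => by
    simp only [(periodic_circleMap 0 1) θ]
  let g : C(AddCircle (2 * Real.pi), ℝ) :=
    ⟨fun x => max (hper.lift x).re 0 + 1, by
      have : Continuous hper.lift := continuous_quot_lift _ (continuous_eval_circleMap q)
      fun_prop⟩
  obtain ⟨r, hr0, hr⟩ := exists_re_eval_near g one_pos
  have hg : ∀ θ : ℝ, g θ = max (q.eval (circleMap 0 1 θ)).re 0 + 1 := fun θ => rfl
  simp only [hg, abs_lt] at hr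
  set s := r - q with hs
  have hs0 : (s.eval 0).im = 0 := by simp [hs, hr0, hq0]
  have hsre : ∀ θ : ℝ, (s.eval (circleMap 0 1 θ)).re =
    (r.eval (circleMap 0 1 θ)).re - (q.eval (circleMap 0 1 θ)).re := fun θ => by simp [hs]
  have hr1 : ∀ θ : ℝ, 0 ≤ (r.eval (circleMap 0 1 θ)).re ∧
      (r.eval (circleMap 0 1 θ)).re ≤ |(q.eval (circleMap 0 1 θ)).re| + 2 := fun θ => by
    have h1 := hr θ
    have h2 : max (q.eval (circleMap 0 1 θ)).re 0 ≤ |(q.eval (circleMap 0 1 θ)).re| :=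
      max_le (le_abs_self _) (abs_nonneg _)
    have h3 := le_max_right (q.eval (circleMap 0 1 θ)).re 0
    constructor <;> linarith
  have hs1 : ∀ θ : ℝ, 0 ≤ (s.eval (circleMap 0 1 θ)).re ∧
      (s.eval (circleMap 0 1 θ)).re ≤ |(q.eval (circleMap 0 1 θ)).re| + 2 := fun θ => by
    have h1 := hr θ
    rw [hsre]
    rcases max_cases (q.eval (circleMap 0 1 θ)).re 0 with ⟨h2, h3⟩ | ⟨h2, h3⟩
    · rw [abs_of_nonneg h3]; constructor <;> linarith
    · rw [abs_of_neg h3]; constructor <;> linarith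
  have hcq : Continuous fun θ : ℝ => (q.eval (circleMap 0 1 θ)).re :=
    Complex.continuous_re.comp (continuous_eval_circleMap q)
  have hI : Integrable (fun θ => zygmundWeight (2 * |(q.eval (circleMap 0 1 θ)).re|))
      angleMeasure :=
    ((continuous_zygmundWeight_const_mul_abs zero_le_two).comp hcq).integrable_angleMeasure
  have hbound : ∀ p : ℂ[X], (p.eval 0).im = 0 → (∀ θ : ℝ, 0 ≤ (p.eval (circleMap 0 1 θ)).re ∧
      (p.eval (circleMap 0 1 θ)).re ≤ |(q.eval (circleMap 0 1 θ)).re| + 2) →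
      ∫ θ, ‖p.eval (circleMap 0 1 θ)‖ ∂angleMeasure ≤
        7 * ((∫ θ, zygmundWeight (2 * |(q.eval (circleMap 0 1 θ)).re|) ∂angleMeasure) +
          2 * Real.pi * zygmundWeight 4) + 26 * Real.pi := fun p hp0 hp => by
    refine (integral_norm_eval_le_of_re_nonneg hp0 fun θ => (hp θ).1).trans ?_
    rw [← integral_angleMeasure_const, ← integral_add hI (integrable_const _)]
    refine add_le_add (mul_le_mul_of_nonneg_left ?_ (by norm_num)) le_rfl
    refine integral_mono_of_nonneg (ae_of_all _ fun θ => zygmundWeight_nonneg (hp θ).1)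
      (hI.add (integrable_const _)) (ae_of_all _ fun θ => ?_)
    refine (zygmundWeight_mono (hp θ).1 (hp θ).2).trans ?_
    refine (zygmundWeight_add_le (abs_nonneg _) zero_le_two).trans_eq ?_
    norm_num
  have hsub : ∫ θ, ‖q.eval (circleMap 0 1 θ)‖ ∂angleMeasure ≤
      (∫ θ, ‖r.eval (circleMap 0 1 θ)‖ ∂angleMeasure) +
        ∫ θ, ‖s.eval (circleMap 0 1 θ)‖ ∂angleMeasure := by
    have hi := fun p : ℂ[X] => (isHardy_eval p).integrable.norm
    rw [← integral_add (hi r) (hi s)]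
    refine integral_mono (hi q) ((hi r).add (hi s)) fun θ => ?_
    have : q.eval (circleMap 0 1 θ) = r.eval (circleMap 0 1 θ) - s.eval (circleMap 0 1 θ) := by
      simp [hs]
    simp only [this]
    exact norm_sub_le _ _
  have h1 := hbound r hr0 hr1
  have h2 := hbound s hs0 hs1
  have h3 : 0 ≤ ∫ θ, zygmundWeight (2 * |(q.eval (circleMap 0 1 θ)).re|) ∂angleMeasure :=
    integral_nonneg fun θ => zygmundWeight_nonneg (by positivity)
  have h4 : 0 ≤ Real.pi * zygmundWeight 4 :=
    mul_nonneg Real.pi_pos.le (zygmundWeight_nonneg (by norm_num))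
  nlinarith [mul_nonneg h4 h3, mul_nonneg Real.pi_pos.le h3]

/-! ### Functions of class `L log L` are real parts of functions in the Hardy class -/

theorem continuous_clamp (N : ℝ) : Continuous fun x : ℝ => max (-N) (min x N) := by fun_prop

theorem abs_sub_clamp_le {N : ℝ} (hN : 0 ≤ N) (x : ℝ) : |x - max (-N) (min x N)| ≤ |x| := by
  rw [abs_le]
  constructor <;> cases abs_cases x <;> cases max_cases (-N) (min x N) <;>
    cases min_cases x N <;> linarith

theorem abs_clamp_le {N : ℝ} (hN : 0 ≤ N) (x : ℝ) : |max (-N) (min x N)| ≤ N := by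
  rw [abs_le]
  exact ⟨le_max_left _ _, max_le (by linarith) (min_le_right _ _)⟩

theorem integrable_zygmundWeight_const_mul {v : ℝ → ℝ} (hv : Integrable v angleMeasure)
    (hΦ : Integrable (fun θ => zygmundWeight |v θ|) angleMeasure) {c : ℝ} (hc : 1 ≤ c) :
    Integrable (fun θ => zygmundWeight (c * |v θ|)) angleMeasure := by
  refine ((hv.abs.const_mul (c * Real.log c)).add (hΦ.const_mul c)).mono'
    ((continuous_zygmundWeight_const_mul_abs (by linarith)).comp_aestronglyMeasurable
      hv.aestronglyMeasurable) (ae_of_all _ fun θ => ?_)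
  rw [Real.norm_of_nonneg (zygmundWeight_nonneg (by positivity))]
  exact zygmundWeight_mul_le hc (abs_nonneg _)

/-- Real parts of polynomials are dense in `L log L`: a truncation of `v` is close to `v` in
`L log L`, and the polynomial is chosen close to the truncation in `L²`. -/
theorem exists_re_eval_zygmundWeight_le {v : ℝ → ℝ} (hv : Integrable v angleMeasure)
    (hΦ : Integrable (fun θ => zygmundWeight |v θ|) angleMeasure) {c : ℝ} (hc : 1 ≤ c) :
    ∃ q : ℂ[X], (q.eval 0).im = 0 ∧
      Integrable (fun θ => zygmundWeight (c * |v θ - (q.eval (circleMap 0 1 θ)).re|))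
        angleMeasure ∧
      ∫ θ, zygmundWeight (c * |v θ - (q.eval (circleMap 0 1 θ)).re|) ∂angleMeasure ≤ 1 := by
  have h2c : 0 ≤ 2 * c := by linarith
  have hi2 := integrable_zygmundWeight_const_mul hv hΦ (c := 2 * c) (by linarith)
  have hmeasT : ∀ N : ℝ, AEStronglyMeasurable (fun θ => max (-N) (min (v θ) N)) angleMeasure :=
    fun N => (continuous_clamp N).comp_aestronglyMeasurable hv.aestronglyMeasurable
  have hmeas1 : ∀ N : ℝ, AEStronglyMeasurable
      (fun θ => zygmundWeight (2 * c * |v θ - max (-N) (min (v θ) N)|)) angleMeasure := fun N =>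
    (continuous_zygmundWeight_const_mul_abs h2c).comp_aestronglyMeasurable
      (hv.aestronglyMeasurable.sub (hmeasT N))
  have hbd : ∀ (N : ℕ) (θ : ℝ),
      ‖zygmundWeight (2 * c * |v θ - max (-(N : ℝ)) (min (v θ) N)|)‖ ≤
        zygmundWeight (2 * c * |v θ|) := fun N θ => by
    rw [Real.norm_of_nonneg (zygmundWeight_nonneg (by positivity))]
    exact zygmundWeight_mono (by positivity)
      (mul_le_mul_of_nonneg_left (abs_sub_clamp_le N.cast_nonneg _) h2c)
  have hlim : Tendsto (fun N : ℕ => ∫ θ, zygmundWeight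
      (2 * c * |v θ - max (-(N : ℝ)) (min (v θ) N)|) ∂angleMeasure) atTop (𝓝 0) := by
    have := tendsto_integral_of_dominated_convergence (μ := angleMeasure) (f := fun _ => 0)
      _ (fun N : ℕ => hmeas1 N) hi2 (fun N => ae_of_all _ (hbd N)) (ae_of_all _ fun θ => ?_)
    · simpa using this
    · refine tendsto_const_nhds.congr' ?_
      filter_upwards [eventually_ge_atTop ⌈|v θ|⌉₊] with N hN
      have h1 := abs_le.1 (Nat.ceil_le.1 hN)
      rw [min_eq_left h1.2, max_eq_right h1.1]
      simp [zygmundWeight]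
  obtain ⟨N, hN⟩ := (hlim.eventually (gt_mem_nhds (half_pos one_pos))).exists
  have hmem : MemLp (fun θ => max (-(N : ℝ)) (min (v θ) N)) 2 angleMeasure :=
    MemLp.of_bound (hmeasT N) N (ae_of_all _ fun θ => abs_clamp_le N.cast_nonneg _)
  obtain ⟨q, hq0, hq⟩ := exists_re_eval_integral_sq_sub_le hmem (ε := 1 / (8 * c ^ 2))
    (by positivity)
  have hcq : Continuous fun θ : ℝ => (q.eval (circleMap 0 1 θ)).re :=
    Complex.continuous_re.comp (continuous_eval_circleMap q)
  have hI1 : Integrable (fun θ => zygmundWeight (2 * c * |v θ - max (-(N : ℝ)) (min (v θ) N)|))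
      angleMeasure := hi2.mono' (hmeas1 N) (ae_of_all _ (hbd N))
  have hI2 : Integrable (fun θ => (2 * c) ^ 2 *
      (max (-(N : ℝ)) (min (v θ) N) - (q.eval (circleMap 0 1 θ)).re) ^ 2) angleMeasure := by
    refine Integrable.const_mul (MemLp.integrable_sq (hmem.sub ?_)) _
    exact (memLp_two_iff_integrable_sq hcq.aestronglyMeasurable).2
      (hcq.pow 2).integrable_angleMeasure
  have hle : ∀ θ, zygmundWeight (c * |v θ - (q.eval (circleMap 0 1 θ)).re|) ≤
      zygmundWeight (2 * c * |v θ - max (-(N : ℝ)) (min (v θ) N)|) + (2 * c) ^ 2 *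
        (max (-(N : ℝ)) (min (v θ) N) - (q.eval (circleMap 0 1 θ)).re) ^ 2 := fun θ => by
    have h1 := mul_le_mul_of_nonneg_left (abs_sub_le (v θ) (max (-(N : ℝ)) (min (v θ) N))
      (q.eval (circleMap 0 1 θ)).re) (by linarith : 0 ≤ c)
    rw [mul_add] at h1
    refine (zygmundWeight_mono (by positivity) h1).trans ((zygmundWeight_add_le (by positivity)
      (by positivity)).trans ?_)
    rw [← mul_assoc, ← mul_assoc]
    refine add_le_add le_rfl ((zygmundWeight_le_sq (by positivity)).trans_eq ?_)
    rw [mul_pow _ |_|, sq_abs]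
  refine ⟨q, hq0, (hI1.add hI2).mono' ?_ (ae_of_all _ fun θ => ?_), ?_⟩
  · exact (continuous_zygmundWeight_const_mul_abs (by linarith)).comp_aestronglyMeasurable
      (hv.aestronglyMeasurable.sub hcq.aestronglyMeasurable)
  · rw [Real.norm_of_nonneg (zygmundWeight_nonneg (by positivity))]
    exact hle θ
  · refine (integral_mono_of_nonneg (ae_of_all _ fun θ => zygmundWeight_nonneg (by positivity))
      (hI1.add hI2) (ae_of_all _ hle)).trans ?_
    simp only [Pi.add_apply]
    rw [integral_add hI1 hI2, integral_const_mul]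
    have h1 := mul_le_mul_of_nonneg_left hq (sq_nonneg (2 * c))
    have h2 : (2 * c) ^ 2 * (1 / (8 * c ^ 2)) = 1 / 2 := by
      have : c ≠ 0 := by linarith
      field_simp
      norm_num
    linarith

/-- Zygmund's theorem: a real function of class `L log L` is the real part of a function in
`H¹(𝕋)`. -/
theorem exists_isHardy_re_eq {v : ℝ → ℝ} (hv : Integrable v angleMeasure)
    (hΦ : Integrable (fun θ => zygmundWeight |v θ|) angleMeasure) :
    ∃ f : ℝ → ℂ, IsHardy f ∧ ∀ᵐ θ ∂angleMeasure, (f θ).re = v θ := by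
  choose q hq0 hqi hq using fun n : ℕ => exists_re_eval_zygmundWeight_le hv hΦ
    (c := 4 * 2 ^ n) (by linarith [one_le_pow₀ (one_le_two : (1 : ℝ) ≤ 2) (n := n)])
  obtain ⟨C, hC0, hC⟩ := exists_integral_norm_eval_le
  have hH := fun n => isHardy_eval (q n)
  have hcq : ∀ n, Continuous fun θ : ℝ => ((q n).eval (circleMap 0 1 θ)).re := fun n =>
    Complex.continuous_re.comp (continuous_eval_circleMap _)
  -- The polynomials form a Cauchy sequence in `L¹` by Zygmund's inequality for `2 ^ N (qₙ - qₘ)`.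
  have hcauchy : ∀ N n m : ℕ, N ≤ n → N ≤ m →
      ∫ θ, ‖(q n).eval (circleMap 0 1 θ) - (q m).eval (circleMap 0 1 θ)‖ ∂angleMeasure ≤
        3 * C * (1 / 2) ^ N := by
    intro N n m hn hm
    have h1 := hC (Polynomial.C (2 ^ N) * (q n - q m)) (by
      have h2 : ((2 : ℂ) ^ N) = ((2 ^ N : ℝ) : ℂ) := by push_cast; rfl
      rw [eval_mul, eval_C, h2, Complex.im_ofReal_mul]
      simp [hq0])
    have h2 : ∀ θ : ℝ, zygmundWeight (2 * |((Polynomial.C (2 ^ N) * (q n - q m)).eval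
        (circleMap 0 1 θ)).re|) ≤
          zygmundWeight (4 * 2 ^ n * |v θ - ((q n).eval (circleMap 0 1 θ)).re|) +
          zygmundWeight (4 * 2 ^ m * |v θ - ((q m).eval (circleMap 0 1 θ)).re|) := fun θ => by
      have h3 : ((2 : ℂ) ^ N) = ((2 ^ N : ℝ) : ℂ) := by push_cast; rfl
      rw [eval_mul, eval_C, h3, Complex.re_ofReal_mul, eval_sub, Complex.sub_re, abs_mul,
        abs_of_pos (by positivity : (0 : ℝ) < 2 ^ N)]
      have h4 := abs_sub_le ((q n).eval (circleMap 0 1 θ)).re (v θ)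
        ((q m).eval (circleMap 0 1 θ)).re
      rw [abs_sub_comm _ (v θ)] at h4
      have h5 := mul_le_mul_of_nonneg_left h4 (by positivity : (0 : ℝ) ≤ 2 * 2 ^ N)
      rw [mul_add] at h5
      rw [← mul_assoc]
      refine (zygmundWeight_mono (by positivity) h5).trans ((zygmundWeight_add_le (by positivity)
        (by positivity)).trans ?_)
      have hpow : ∀ k, N ≤ k → (2 : ℝ) ^ N ≤ 2 ^ k := fun k hk =>
        pow_le_pow_right₀ one_le_two hk
      refine add_le_add (zygmundWeight_mono (by positivity) ?_)
        (zygmundWeight_mono (by positivity) ?_)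
      · nlinarith [mul_le_mul_of_nonneg_right (hpow n hn)
          (abs_nonneg (v θ - ((q n).eval (circleMap 0 1 θ)).re))]
      · nlinarith [mul_le_mul_of_nonneg_right (hpow m hm)
          (abs_nonneg (v θ - ((q m).eval (circleMap 0 1 θ)).re))]
    have h3 : ∫ θ, zygmundWeight (2 * |((Polynomial.C (2 ^ N) * (q n - q m)).eval
        (circleMap 0 1 θ)).re|) ∂angleMeasure ≤ 1 + 1 := by
      refine (integral_mono_of_nonneg (ae_of_all _ fun θ => zygmundWeight_nonneg (by positivity))
        ((hqi n).add (hqi m)) (ae_of_all _ h2)).trans ?_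
      simp only [Pi.add_apply]
      rw [integral_add (hqi n) (hqi m)]
      exact add_le_add (hq n) (hq m)
    have h4 : ∀ θ : ℝ, ‖(Polynomial.C (2 ^ N) * (q n - q m)).eval (circleMap 0 1 θ)‖ =
        2 ^ N * ‖(q n).eval (circleMap 0 1 θ) - (q m).eval (circleMap 0 1 θ)‖ := fun θ => by
      simp
    simp only [h4] at h1
    rw [integral_const_mul] at h1
    have h5 := h1.trans (mul_le_mul_of_nonneg_left (add_le_add_left h3 1) hC0.le)
    rw [one_div, inv_pow, ← div_eq_mul_inv, le_div_iff₀ (by positivity)]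
    linarith
  obtain ⟨f, hf, hlim⟩ := Lp.cauchy_complete_eLpNorm (μ := angleMeasure) (p := 1) le_rfl
    (f := fun n θ => (q n).eval (circleMap 0 1 θ))
    (fun n => memLp_one_iff_integrable.2 (hH n).integrable)
    (B := fun N => ENNReal.ofReal (4 * C * (1 / 2) ^ N))
    ((summable_geometric_of_lt_one (by norm_num) (by norm_num)).mul_left _).tsum_ofReal_ne_top
    (fun N n m hn hm => by
      rw [eLpNorm_one_eq_lintegral_enorm,
        ← ofReal_integral_norm_eq_lintegral_enorm ((hH n).integrable.sub (hH m).integrable)]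
      refine (ENNReal.ofReal_lt_ofReal_iff (by positivity)).2
        ((hcauchy N n m hn hm).trans_lt ?_)
      have : 0 < C * (1 / 2) ^ N := by positivity
      linarith)
  have hfi : Integrable f angleMeasure := memLp_one_iff_integrable.1 hf
  have hL1 : Tendsto (fun n => ∫ θ, ‖(q n).eval (circleMap 0 1 θ) - f θ‖ ∂angleMeasure) atTop
      (𝓝 0) := by
    have h1 := (ENNReal.tendsto_toReal ENNReal.zero_ne_top).comp hlim
    refine h1.congr fun n => ?_
    simp only [Function.comp_apply]
    rw [eLpNorm_one_eq_lintegral_enorm,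
      ← integral_norm_eq_lintegral_enorm ((hH n).integrable.sub hfi).aestronglyMeasurable]
    rfl
  refine ⟨f, ⟨hfi, fun k hk => ?_⟩, ?_⟩
  · refine norm_le_zero_iff.1 (ge_of_tendsto' hL1 fun n => ?_)
    have hmul : ∀ {g : ℝ → ℂ}, Integrable g angleMeasure →
        Integrable (fun θ => g θ * circleMap 0 1 θ ^ k) angleMeasure := fun {g} hg =>
      hg.mul_bdd (c := 1) ((continuous_circleMap 0 1).pow k).aestronglyMeasurable
        (ae_of_all _ fun θ => by simp)
    have hsub := integral_sub (hmul (hH n).integrable) (hmul hfi)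
    rw [(hH n).integral_mul_pow k hk, zero_sub] at hsub
    rw [← norm_neg, ← hsub]
    refine (norm_integral_le_integral_norm _).trans_eq ?_
    refine integral_congr_ae (ae_of_all _ fun θ => ?_)
    simp [← sub_mul]
  · have hfre : Integrable (fun θ => (f θ).re) angleMeasure := hfi.re
    have hvq : ∀ n, ∫ θ, |v θ - ((q n).eval (circleMap 0 1 θ)).re| ∂angleMeasure ≤
        (1 + 4 * Real.pi) * (1 / 2) ^ n := fun n => by
      have h1 : ∀ θ, 2 ^ n * |v θ - ((q n).eval (circleMap 0 1 θ)).re| ≤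
          zygmundWeight (4 * 2 ^ n * |v θ - ((q n).eval (circleMap 0 1 θ)).re|) + 2 := fun θ => by
        have h2 : 0 ≤ 2 ^ n * |v θ - ((q n).eval (circleMap 0 1 θ)).re| := by positivity
        refine le_trans ?_ (le_zygmundWeight_add_two (by positivity))
        linarith
      have h2 := integral_mono_of_nonneg (ae_of_all _ fun θ => by positivity)
        ((hqi n).add (integrable_const 2)) (ae_of_all _ h1)
      simp only [Pi.add_apply] at h2
      rw [integral_const_mul, integral_add (hqi n) (integrable_const 2),
        integral_angleMeasure_const] at h2
      rw [one_div, inv_pow, ← div_eq_mul_inv, le_div_iff₀ (by positivity)]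
      linarith [hq n]
    have hdist : ∫ θ, |(f θ).re - v θ| ∂angleMeasure ≤ 0 := by
      have hgeo : Tendsto (fun n : ℕ => (1 + 4 * Real.pi) * (1 / 2 : ℝ) ^ n) atTop (𝓝 0) := by
        simpa using (tendsto_pow_atTop_nhds_zero_of_lt_one (r := (1 / 2 : ℝ)) (by norm_num)
          (by norm_num)).const_mul (1 + 4 * Real.pi)
      have hsum := hL1.add hgeo
      rw [add_zero] at hsum
      refine ge_of_tendsto' hsum fun n => ?_
      have hi1 := ((hH n).integrable.sub hfi).norm
      have hi2 : Integrable (fun θ => |v θ - ((q n).eval (circleMap 0 1 θ)).re|) angleMeasure :=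
        (hv.sub (hcq n).integrable_angleMeasure).abs
      refine le_trans ?_ (add_le_add le_rfl (hvq n))
      refine (integral_mono (hfre.sub hv).abs (hi1.add hi2) fun θ => ?_).trans_eq
        (integral_add hi1 hi2)
      have h1 := Complex.abs_re_le_norm ((q n).eval (circleMap 0 1 θ) - f θ)
      have h2 := abs_sub_le (f θ).re ((q n).eval (circleMap 0 1 θ)).re (v θ)
      rw [Complex.sub_re, abs_sub_comm] at h1
      rw [abs_sub_comm ((q n).eval (circleMap 0 1 θ)).re (v θ)] at h2
      exact h2.trans (add_le_add h1 le_rfl)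
    have h0 := (integral_eq_zero_iff_of_nonneg (fun θ => abs_nonneg _) (hfre.sub hv).abs).1
      (le_antisymm hdist (integral_nonneg fun θ => abs_nonneg _))
    filter_upwards [h0] with θ hθ
    exact sub_eq_zero.1 (abs_eq_zero.1 hθ)

/-! ### Spectral shift functions and the Hardy class -/

theorem HasTrace.unique {H : Type*} [NormedAddCommGroup H] [InnerProductSpace ℂ H]
    [CompleteSpace H] {A : H →L[ℂ] H} {s t : ℂ} (hs : HasTrace A s) (ht : HasTrace A t) :
    s = t := by
  obtain ⟨w, e, -⟩ := exists_hilbertBasis ℂ H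
  exact (hs.2 w e).unique (ht.2 w e)

theorem sub_ne_zero_of_norm_le_one_lt {z l : ℂ} (hz : ‖z‖ ≤ 1) (hl : 1 < ‖l‖) : z - l ≠ 0 := by
  rintro h
  rw [sub_eq_zero.1 h] at hz
  linarith

theorem continuous_circleMap_div_sub_sq {l : ℂ} (hl : 1 < ‖l‖) :
    Continuous fun θ : ℝ => circleMap 0 1 θ / (circleMap 0 1 θ - l) ^ 2 :=
  (continuous_circleMap 0 1).div (((continuous_circleMap 0 1).sub continuous_const).pow 2)
    fun θ => pow_ne_zero 2 (sub_ne_zero_of_norm_le_one_lt (norm_circleMap_zero_one θ).le hl)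

theorem MeasureTheory.Integrable.mul_continuous_angleMeasure {f g : ℝ → ℂ}
    (hf : Integrable f angleMeasure) (hg : Continuous g) :
    Integrable (fun θ => f θ * g θ) angleMeasure := by
  obtain ⟨C, hC⟩ := (isCompact_Icc (a := (0 : ℝ)) (b := 2 * Real.pi)).exists_bound_of_continuousOn
    hg.continuousOn
  refine hf.mul_bdd (c := C) hg.aestronglyMeasurable ?_
  exact (ae_restrict_iff' measurableSet_Ioc).2
    (ae_of_all _ fun θ hθ => hC θ (Set.Ioc_subset_Icc_self hθ))

/-- The difference of the right-hand sides of the trace formula for `ξ` and for `η`. -/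
theorem circleIntegral_div_sub_sq_sub {ξ η : ℂ → ℂ} (hξ : CircleIntegrable ξ 0 1)
    (hη : CircleIntegrable η 0 1) {l : ℂ} (hl : 1 < ‖l‖) :
    (∮ z in C(0, 1), ξ z / (z - l) ^ 2) - (∮ z in C(0, 1), η z / (z - l) ^ 2) =
      Complex.I * ∫ θ, (ξ (circleMap 0 1 θ) - η (circleMap 0 1 θ)) *
        (circleMap 0 1 θ / (circleMap 0 1 θ - l) ^ 2) ∂angleMeasure := by
  have hc := continuous_circleMap_div_sub_sq hl
  have h1 := (circleIntegrable_iff_integrable_angleMeasure.1 hξ).mul_continuous_angleMeasure hc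
  have h2 := (circleIntegrable_iff_integrable_angleMeasure.1 hη).mul_continuous_angleMeasure hc
  have h3 : ∀ g : ℂ → ℂ, (∮ z in C(0, 1), g z / (z - l) ^ 2) = Complex.I *
      ∫ θ, g (circleMap 0 1 θ) * (circleMap 0 1 θ / (circleMap 0 1 θ - l) ^ 2) ∂angleMeasure := by
    intro g
    rw [circleIntegral_eq_integral_angleMeasure, ← integral_const_mul]
    exact integral_congr_ae (ae_of_all _ fun θ => by ring)
  simp only [sub_mul]
  rw [integral_sub h1 h2, h3, h3, mul_sub]

/-- The trace formula for all `|l| > 1` determines the Fourier coefficients of negative index. -/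
theorem IsHardy.of_integral_mul_div_sub_sq {D : ℝ → ℂ} (hD : Integrable D angleMeasure)
    (h : ∀ l : ℂ, 1 < ‖l‖ →
      ∫ θ, D θ * (circleMap 0 1 θ / (circleMap 0 1 θ - l) ^ 2) ∂angleMeasure = 0) :
    IsHardy D := by
  refine ⟨hD, fun k hk => ?_⟩
  -- Expand in powers of `t = l⁻¹`: `z / (z - l) ^ 2 = t * ∑ n, n (t z) ^ n`.
  have hsum : ∀ t : ℂ, ‖t‖ < 1 →
      HasSum (fun n : ℕ => t ^ n • (n * ∫ θ, D θ * circleMap 0 1 θ ^ n ∂angleMeasure)) 0 := by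
    intro t ht
    have hnorm : ∀ θ : ℝ, ‖t * circleMap 0 1 θ‖ < 1 := fun θ => by simpa using ht
    have hint : ∀ n : ℕ, Integrable (fun θ => D θ * (n * (t * circleMap 0 1 θ) ^ n))
        angleMeasure := fun n =>
      hD.mul_continuous_angleMeasure (by have := continuous_circleMap 0 1; fun_prop)
    have hs := hasSum_integral_of_summable_integral_norm hint (by
      have hgeo := (hasSum_coe_mul_geometric_of_norm_lt_one (r := ‖t‖) (by simpa using ht)).summable
      refine (hgeo.mul_left (∫ θ, ‖D θ‖ ∂angleMeasure)).congr fun n => ?_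
      rw [← integral_mul_const]
      exact integral_congr_ae (ae_of_all _ fun θ => by simp))
    have hz : ∫ θ, ∑' n : ℕ, D θ * (n * (t * circleMap 0 1 θ) ^ n) ∂angleMeasure = 0 := by
      have h1 : ∀ θ, ∑' n : ℕ, D θ * (n * (t * circleMap 0 1 θ) ^ n) =
          D θ * (t * circleMap 0 1 θ / (1 - t * circleMap 0 1 θ) ^ 2) := fun θ =>
        ((hasSum_coe_mul_geometric_of_norm_lt_one (hnorm θ)).mul_left (D θ)).tsum_eq
      simp only [h1]
      rcases eq_or_ne t 0 with rfl | ht0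
      · simp
      have hl : 1 < ‖t⁻¹‖ := by
        rw [norm_inv]; exact (one_lt_inv₀ (norm_pos_iff.2 ht0)).2 ht
      have h2 := h t⁻¹ hl
      have h3 : ∀ θ : ℝ, D θ * (t * circleMap 0 1 θ / (1 - t * circleMap 0 1 θ) ^ 2) =
          t⁻¹ * (D θ * (circleMap 0 1 θ / (circleMap 0 1 θ - t⁻¹) ^ 2)) := fun θ => by
        have h4 := sub_ne_zero_of_norm_le_one_lt (norm_circleMap_zero_one θ).le hl
        have h5 : 1 - t * circleMap 0 1 θ = -t * (circleMap 0 1 θ - t⁻¹) := by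
          field_simp; ring
        rw [h5]
        field_simp
      simp only [h3]
      rw [integral_const_mul, h2, mul_zero]
    rw [hz] at hs
    convert! hs using 2 with n
    have h1 : ∀ θ : ℝ, D θ * (n * (t * circleMap 0 1 θ) ^ n) =
        t ^ n * n * (D θ * circleMap 0 1 θ ^ n) := fun θ => by ring
    simp only [h1]
    rw [integral_const_mul, smul_eq_mul, mul_assoc]
  have hps : HasFPowerSeriesAt (fun _ : ℂ => (0 : ℂ)) (FormalMultilinearSeries.ofScalars ℂ
      fun n : ℕ => (n : ℂ) * ∫ θ, D θ * circleMap 0 1 θ ^ n ∂angleMeasure) 0 := by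
    rw [hasFPowerSeriesAt_iff]
    filter_upwards [Metric.ball_mem_nhds (0 : ℂ) one_pos] with t ht
    simpa only [FormalMultilinearSeries.coeff_ofScalars] using hsum t (by simpa using ht)
  have h0 := congrArg (fun p => FormalMultilinearSeries.coeff p k) hps.eq_zero
  simp only [FormalMultilinearSeries.coeff_ofScalars] at h0
  have h1 : (k : ℂ) * ∫ θ, D θ * circleMap 0 1 θ ^ k ∂angleMeasure = 0 := h0
  exact (mul_eq_zero.1 h1).resolve_left (by exact_mod_cast hk)

section

variable {H : Type*} [NormedAddCommGroup H] [InnerProductSpace ℂ H] [CompleteSpace H]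
  {T₁ T₀ : H →L[ℂ] H} {ξ η : ℂ → ℂ}

theorem IsSpectralShiftFunction.isHardy_sub (hξ : IsSpectralShiftFunction T₁ T₀ ξ)
    (hη : IsSpectralShiftFunction T₁ T₀ η) :
    IsHardy fun θ => ξ (circleMap 0 1 θ) - η (circleMap 0 1 θ) := by
  refine .of_integral_mul_div_sub_sq
    ((circleIntegrable_iff_integrable_angleMeasure.1 hξ.1).sub
      (circleIntegrable_iff_integrable_angleMeasure.1 hη.1)) fun l hl => ?_
  have h1 := circleIntegral_div_sub_sq_sub hξ.1 hη.1 hl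
  rw [neg_injective ((hξ.2 l hl).unique (hη.2 l hl)), sub_self] at h1
  exact (mul_eq_zero.1 h1.symm).resolve_left Complex.I_ne_zero

theorem IsSpectralShiftFunction.of_isHardy_sub (hξ : IsSpectralShiftFunction T₁ T₀ ξ)
    (hη : CircleIntegrable η 0 1)
    (h : IsHardy fun θ => ξ (circleMap 0 1 θ) - η (circleMap 0 1 θ)) :
    IsSpectralShiftFunction T₁ T₀ η := by
  refine ⟨hη, fun l hl => ?_⟩
  have h1 := circleIntegral_div_sub_sq_sub hξ.1 hη hl
  have hG : DiffContOnCl ℂ (fun z => z / (z - l) ^ 2) (Metric.ball 0 1) := by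
    refine DifferentiableOn.diffContOnCl ?_
    rw [closure_ball _ one_ne_zero]
    refine DifferentiableOn.div (by fun_prop) (by fun_prop) fun z hz => pow_ne_zero 2
      (sub_ne_zero_of_norm_le_one_lt (mem_closedBall_zero_iff.1 hz) hl)
  -- The kernel `z / (z - l) ^ 2` vanishes at the origin.
  rw [h.integral_mul_eq hG, zero_div, zero_mul, mul_zero, sub_eq_zero] at h1
  rw [← h1]
  exact hξ.2 l hl

end

/-- Every function of the angle is, up to null sets, a function on the circle. -/
theorem exists_comp_circleMap_eq {α : Type*} (f : ℝ → α) :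
    ∃ F : ℂ → α, ∀ᵐ θ ∂angleMeasure, F (circleMap 0 1 θ) = f θ := by
  refine ⟨fun z => f (toIocMod Real.two_pi_pos 0 z.arg), ?_⟩
  refine (ae_restrict_iff' measurableSet_Ioc).2 (ae_of_all _ fun θ hθ => ?_)
  have h1 : circleMap 0 1 θ = Complex.exp (θ * Complex.I) := by simp [circleMap]
  simp only [h1, Complex.arg_exp_mul_I]
  congr 1
  rw [toIocMod_toIocMod]
  exact (toIocMod_eq_self _).2 (by simpa using hθ)

theorem theorem7p3 {H : Type*} [NormedAddCommGroup H] [InnerProductSpace ℂ H] [CompleteSpace H]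
    (T₁ T₀ : H →L[ℂ] H) (hT₁ : ‖T₁‖ ≤ 1) (hT₀ : ‖T₀‖ ≤ 1) (hT : IsTraceClass (T₁ - T₀))
    (ξ : ℂ → ℂ) (hξ : IsSpectralShiftFunction T₁ T₀ ξ) :
    (ImLogIntegrable ξ → HasRealSpectralShiftFunction T₁ T₀) ∧
      ((∀ᵐ θ : ℝ, 0 ≤ (ξ (circleMap 0 1 θ)).im) →
        HasRealSpectralShiftFunction T₁ T₀ → ImLogIntegrable ξ) := by
  have hξi := circleIntegrable_iff_integrable_angleMeasure.1 hξ.1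
  have him : Integrable (fun θ => (ξ (circleMap 0 1 θ)).im) angleMeasure := hξi.im
  constructor
  · intro hlog
    have hlog' := circleIntegrable_iff_integrable_angleMeasure.1 hlog
    obtain ⟨f, hf, hre⟩ := exists_isHardy_re_eq him
      (hlog'.norm.congr (ae_of_all _ fun θ => by
        simp only [Real.norm_eq_abs]
        rw [abs_mul, abs_of_nonneg (Real.log_nonneg (by simp))]
        rfl))
    -- `I * f` has the imaginary part of `ξ`, so that `ξ - I * f` is real-valued.
    obtain ⟨η, hη⟩ := exists_comp_circleMap_eq fun θ => (ξ (circleMap 0 1 θ) - Complex.I * f θ).re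
    have hdiff : (fun θ => ξ (circleMap 0 1 θ) - Complex.I * f θ) =ᵐ[angleMeasure]
        fun θ => (η (circleMap 0 1 θ) : ℂ) := by
      filter_upwards [hre, hη] with θ h1 h2
      rw [h2]
      apply Complex.ext <;> simp [h1]
    have hIf := hf.const_mul Complex.I
    refine ⟨η, hξ.of_isHardy_sub ?_ ⟨?_, fun k hk => ?_⟩⟩
    · exact circleIntegrable_iff_integrable_angleMeasure.2
        ((hξi.sub hIf.integrable).congr hdiff)
    · exact hξi.sub ((hξi.sub hIf.integrable).congr hdiff)
    · refine (integral_congr_ae ?_).trans (hIf.integral_mul_pow k hk)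
      filter_upwards [hdiff] with θ h1
      rw [← h1, sub_sub_cancel]
  · rintro hpos ⟨η, hη⟩
    have hpos' : ∀ᵐ θ ∂angleMeasure, 0 ≤ (ξ (circleMap 0 1 θ)).im := ae_restrict_of_ae hpos
    have hf := (hξ.isHardy_sub hη).const_mul (-Complex.I)
    have hre : ∀ θ, (-Complex.I * (ξ (circleMap 0 1 θ) - η (circleMap 0 1 θ))).re =
        (ξ (circleMap 0 1 θ)).im := fun θ => by simp
    have h1 := hf.integrable_re_mul_log (by simpa only [hre] using hpos')
    simp only [hre] at h1
    refine circleIntegrable_iff_integrable_angleMeasure.2 (h1.congr ?_)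
    filter_upwards [hpos'] with θ hθ
    rw [abs_of_nonneg hθ]
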